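/- For a finite simple graph $G$ and an (arbitrary, not necessarily proper) edge coloring $c$ of $G$, call $c$ conflict-free if for every edge $uv$ of $G$ some color appears exactly once on the set $E_G(u)\cup E_G(v)$ of edges incident with $u$ or $v$. Let $\chi'_{\rm CF}(G)$ be the least number of colors in a conflict-free edge coloring of $G$, and let $\Delta=\Delta(G)$ be the maximum degree of $G$. Let $G(n,p)$ denote the binomial random graph on $n$ labelled vertices, in which every pair of distinct vertices is an edge independently with probability $p$. There is an absolute constant $C>0$ such that the following holds. Let $\varepsilon\in(0,1)$ be a constant and let $p=p(n)\in[0,1]$ satisfy $p\gg n^{-\varepsilon}$, i.e. $n^{-\varepsilon}/p(n)\to 0$ as $n\to\infty$. Then there is a sequence $\eta_n\to 0$ such that, with probability tending to $1$ as $n\to\infty$, the random graph $G=G(n,p)$ satisfies $$\chi'_{\rm CF}(G)\le \log_2\Delta + C\log_2\log_2\Delta = (1+h)\log_2\Delta \quad\text{for some real } h=h(G) \text{ with } |h|\le\eta_n .$$ In short, asymptotically almost surely $\chi'_{\rm CF}(G)\le\log_2\Delta+O(\log_2\log_2\Delta)=(1+o(1))\log_2\Delta$. -/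

import Mathlib

namespace SimpleGraph

/-- The closed neighborhood `E_G[uv] = E_G(u) ∪ E_G(v)` of an edge `e = uv`: all edges of `G`
incident with an endpoint of `e` (among them `e` itself). -/
def closedEdgeNbhd {V : Type*} (G : SimpleGraph V) (e : G.edgeSet) : Set G.edgeSet :=
  {f | ∃ v ∈ (e : Sym2 V), (f : Sym2 V) ∈ G.incidenceSet v}

/-- The edge `e` is satisfied by the (not necessarily proper) edge coloring `c`: some color
appears exactly once in the closed neighborhood of `e`. -/
def IsSatisfiedBy {V α : Type*} (G : SimpleGraph V) (c : G.edgeSet → α) (e : G.edgeSet) : Prop :=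
  ∃ a : α, ∃! f : G.edgeSet, f ∈ G.closedEdgeNbhd e ∧ c f = a

/-- An edge coloring is conflict-free if every edge is satisfied. -/
def IsConflictFree {V α : Type*} (G : SimpleGraph V) (c : G.edgeSet → α) : Prop :=
  ∀ e : G.edgeSet, G.IsSatisfiedBy c e

/-- The conflict-free chromatic index: the least `k` such that `G` has a conflict-free edge
coloring with colors from a set of size `k`. -/
noncomputable def cfChromaticIndex {V : Type*} (G : SimpleGraph V) : ℕ :=
  sInf {k : ℕ | ∃ c : G.edgeSet → Fin k, G.IsConflictFree c}

/-- For a finite graph the infimum is over a nonempty set, hence is a minimum. -/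
theorem exists_isConflictFree_cfChromaticIndex {V : Type*} [Finite V] (G : SimpleGraph V) :
    ∃ c : G.edgeSet → Fin G.cfChromaticIndex, G.IsConflictFree c := by
  apply Nat.sInf_mem (s := {k : ℕ | ∃ c : G.edgeSet → Fin k, G.IsConflictFree c})
  refine ⟨Nat.card G.edgeSet, Finite.equivFin G.edgeSet, fun e => ?_⟩
  refine ⟨Finite.equivFin G.edgeSet e, e, ⟨?_, rfl⟩, fun f hf => (Equiv.injective _) hf.2⟩
  obtain ⟨⟨u, v⟩, he⟩ := e
  exact ⟨u, Sym2.mem_mk_left u v, he, Sym2.mem_mk_left u v⟩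

/-- The maximum degree `Δ(G)` of a finite graph (Mathlib's, with classical decidability). -/
noncomputable def maxDeg {V : Type*} [Fintype V] (G : SimpleGraph V) : ℕ :=
  open scoped Classical in G.maxDegree

end SimpleGraph

/-! Split the vertices into two halves `a u`, `b u` indexed by the same set `X`, with at most one
vertex left over, and contract each pair `{a u, b u}`. The contracted graph has degrees at most
`2Δ`, so it has a proper coloring by nonempty subsets of `Fin k` as soon as `2 ^ k` exceeds a
constant multiple of `Δ`; thus `k` is `log₂ Δ` plus a constant. Call the subset assigned to `u` its
code.

For each symbol `i` let `A i` be the set of indices whose code contains `i`. Suppose there are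
matchings `M i` in `G`, pairwise disjoint and avoiding the pair edges, such that `M i` covers
exactly the vertices `a u`, `b u` with `u ∈ A i`. Give `M i` the color `i`, the pair edges one
further color, and all other edges a last color. An edge between two pairs joins different codes, so
some `M i` covers exactly one of its endpoints and color `i` occurs once around it. An edge at the
leftover vertex is handled by nonemptiness of codes, and a pair edge by its own color. Hence `k + 2`
colors suffice (`cfChromaticIndex_le_of_pseudorandom`).

The matchings come from Hall's theorem, one symbol at a time. This needs large degrees inside every
`A i`, which a uniformly random proper code provides (`exists_isProperCode_forall_le_card`), and an
edge distribution without small dense or large sparse pairs of sets, which the random bipartite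
graph between the halves has with high probability by Chernoff and union bounds
(`binomialRandom_not_isCrossPseudorandom_le`). The outcome is `log₂ Δ + 7`, and 7 is eventually
below `log₂ log₂ Δ`. -/

open Finset

/-! ### Conflict-free colorings from matchings -/

namespace SimpleGraph

theorem IsConflictFree.cfChromaticIndex_le {V α : Type*} [Fintype α] {G : SimpleGraph V}
    {c : G.edgeSet → α} (hc : G.IsConflictFree c) : G.cfChromaticIndex ≤ Fintype.card α := by
  refine Nat.sInf_le ⟨fun e => Fintype.equivFin α (c e), fun e => ?_⟩
  obtain ⟨a, f, hf, huniq⟩ := hc e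
  exact ⟨Fintype.equivFin α a, f, ⟨hf.1, by simp [hf.2]⟩, fun g hg => huniq g ⟨hg.1, by
    simpa using hg.2⟩⟩

/-- If pairwise disjoint matchings `M a` are such that every edge outside their union has, for some
`a`, exactly one endpoint covered by `M a`, then one more color suffices for a conflict-free
coloring. -/
theorem cfChromaticIndex_le_of_matchings {V α : Type*} [Fintype α] (G : SimpleGraph V)
    (M : α → V → V → Prop) (symm : ∀ a p q, M a p q → M a q p)
    (uniq : ∀ a p q r, M a p q → M a p r → q = r)
    (disj : ∀ a b p q, M a p q → M b p q → a = b)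
    (sep : ∀ p q, G.Adj p q → (∃ a, M a p q) ∨
      ∃ a, ((∃ r, G.Adj p r ∧ M a p r) ∧ ∀ r, ¬ M a q r) ∨
        ((∃ r, G.Adj q r ∧ M a q r) ∧ ∀ r, ¬ M a p r)) :
    G.cfChromaticIndex ≤ Fintype.card α + 1 := by
  classical
  rw [← Fintype.card_option]
  let P : G.edgeSet → α → Prop := fun e a => ∃ p q, (e : Sym2 V) = s(p, q) ∧ M a p q
  -- By `disj` the choice is forced; `none` is the extra color shared by all edges outside the
  -- matchings.
  let c : G.edgeSet → Option α := fun e => if h : ∃ a, P e a then some h.choose else none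
  have hP : ∀ p q h a, P ⟨s(p, q), h⟩ a ↔ M a p q := by
    intro p q h a
    refine ⟨?_, fun h => ⟨p, q, rfl, h⟩⟩
    rintro ⟨p', q', he, hM⟩
    rcases Sym2.eq_iff.1 he with ⟨rfl, rfl⟩ | ⟨rfl, rfl⟩
    exacts [hM, symm _ _ _ hM]
  have hc : ∀ p q h a, c ⟨s(p, q), h⟩ = some a ↔ M a p q := by
    intro p q h a
    simp only [c]
    split_ifs with hex
    · have h1 := (hP p q h _).1 hex.choose_spec
      simp only [Option.some.injEq]
      exact ⟨fun h2 => h2 ▸ h1, fun h2 => disj _ _ _ _ h1 h2⟩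
    · simp only [false_iff]
      exact fun hM => hex ⟨a, (hP p q h a).2 hM⟩
  -- At `p` only `pr` has color `a`. The condition on `q` permits at most the edge `pq` itself, so
  -- it serves both when `pq` lies in the matching and when `q` is uncovered.
  have key : ∀ p q (h : G.Adj p q) r (hr : G.Adj p r) a, M a p r →
      (∀ t, M a q t → t = p ∧ r = q) → G.IsSatisfiedBy c ⟨s(p, q), h⟩ := by
    intro p q h r hr a hM hq
    refine ⟨some a, ⟨s(p, r), hr⟩, ⟨⟨p, by simp, hr, by simp⟩, (hc _ _ _ _).2 hM⟩, ?_⟩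
    rintro ⟨f, hf⟩ ⟨⟨v, hv, -, hvf⟩, hcf⟩
    obtain ⟨t, rfl⟩ := Sym2.mem_iff_exists.1 hvf
    rw [hc] at hcf
    rw [Sym2.mem_iff] at hv
    rcases hv with rfl | rfl
    · obtain rfl := uniq _ _ _ _ hM hcf
      rfl
    · obtain ⟨rfl, rfl⟩ := hq t hcf
      exact Subtype.ext Sym2.eq_swap
  have hswap : ∀ p q (h : G.Adj p q) (h' : G.Adj q p),
      (⟨s(p, q), h⟩ : G.edgeSet) = ⟨s(q, p), h'⟩ := fun p q h h' => Subtype.ext Sym2.eq_swap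
  refine IsConflictFree.cfChromaticIndex_le (c := c) ?_
  rintro ⟨⟨p, q⟩, h : G.Adj p q⟩
  rcases sep p q h with ⟨a, ha⟩ | ⟨a, ⟨⟨r, hr, hM⟩, hn⟩ | ⟨⟨r, hr, hM⟩, hn⟩⟩
  · exact key p q h q h a ha fun t ht => ⟨uniq _ _ _ _ ht (symm _ _ _ ha), rfl⟩
  · exact key p q h r hr a hM fun t ht => (hn t ht).elim
  · have := key q p h.symm r hr a hM fun t ht => (hn t ht).elim
    rw [hswap q p h.symm h] at this
    exact this

end SimpleGraph

/-! ### Perfect matchings by Hall's theorem -/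

/-- Hall's condition in a bipartite relation without small dense or large sparse pairs of sets:
the relation `B`, restricted to `A` and with the pairs in `F` removed, has a perfect matching. -/
theorem exists_injOn_of_pseudorandom {X : Type*} [Fintype X] [DecidableEq X]
    (B F : X → X → Prop) [DecidableRel B] [DecidableRel F] (A : Finset X) (s d K : ℕ)
    (hFr : ∀ u, #{w | F u w} ≤ K) (hFl : ∀ w, #{u | F u w} ≤ K)
    (hr : ∀ u ∈ A, d + K ≤ #{w ∈ A | B u w}) (hl : ∀ w ∈ A, d + K ≤ #{u ∈ A | B u w})
    (up : ∀ t, 0 < t → t ≤ s → ∀ S T : Finset X, #S ≤ t → #T ≤ t →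
      ∑ u ∈ S, #{w ∈ T | B u w} < d * t)
    (low : ∀ S T : Finset X, #S = s → #T = s → K * s < ∑ u ∈ S, #{w ∈ T | B u w}) :
    ∃ f : X → X, Set.InjOn f A ∧ ∀ u ∈ A, f u ∈ A ∧ B u (f u) ∧ ¬ F u (f u) := by
  let N : A → Finset X := fun u => {w ∈ A | B u w ∧ ¬ F u w}
  have hr' : ∀ u ∈ A, d ≤ #{w ∈ A | B u w ∧ ¬ F u w} := by
    intro u hu
    have h1 : #{w ∈ A | B u w} ≤ #{w ∈ A | B u w ∧ ¬ F u w} + #{w | F u w} := by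
      refine (card_le_card ?_).trans (card_union_le _ _)
      intro w
      simp only [mem_filter, mem_union, mem_univ, true_and]
      tauto
    have := hr u hu
    have := hFr u
    omega
  have hl' : ∀ w ∈ A, d ≤ #{u ∈ A | B u w ∧ ¬ F u w} := by
    intro w hw
    have h1 : #{u ∈ A | B u w} ≤ #{u ∈ A | B u w ∧ ¬ F u w} + #{u | F u w} := by
      refine (card_le_card ?_).trans (card_union_le _ _)
      intro u
      simp only [mem_filter, mem_union, mem_univ, true_and]
      tauto
    have := hl w hw
    have := hFl w
    omega
  have hall : ∀ S : Finset A, #S ≤ #(S.biUnion N) := by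
    intro S'
    by_contra! hlt
    set T := S'.biUnion N with hT
    set S : Finset X := S'.map (Function.Embedding.subtype _) with hS
    have hSA : S ⊆ A := by
      intro u hu
      simp only [hS, mem_map, Function.Embedding.coe_subtype] at hu
      obtain ⟨v, -, rfl⟩ := hu
      exact v.2
    have hcS : #S = #S' := card_map _
    have hTA : T ⊆ A := by
      intro w hw
      obtain ⟨u, -, hw⟩ := mem_biUnion.1 hw
      exact (mem_filter.1 hw).1
    have hTmem : ∀ u ∈ S, ∀ w ∈ A, B u w → ¬ F u w → w ∈ T := by
      intro u hu w hw hB hF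
      simp only [hS, mem_map, Function.Embedding.coe_subtype] at hu
      obtain ⟨v, hv, rfl⟩ := hu
      exact mem_biUnion.2 ⟨v, hv, mem_filter.2 ⟨hw, hB, hF⟩⟩
    rw [← hcS] at hlt
    -- Let `T` be the neighborhood of a Hall violator `S`. If `S` is small, its members send `d`
    -- edges each into the smaller set `T`, too many for `up`.
    rcases le_or_gt #S s with hs | hs
    · have h1 := up #S (by omega) hs S T le_rfl hlt.le
      have h2 : ∑ u ∈ S, d ≤ ∑ u ∈ S, #{w ∈ T | B u w} := by
        refine sum_le_sum fun u hu => (hr' u (hSA hu)).trans (card_le_card ?_)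
        intro w hw
        simp only [mem_filter] at hw ⊢
        exact ⟨hTmem u hu w hw.1 hw.2.1 hw.2.2, hw.2.1⟩
      rw [sum_const, smul_eq_mul, mul_comm] at h2
      omega
    · have hcU : #(A \ T) = #A - #T := card_sdiff_of_subset hTA
      have hcR : #(A \ S) = #A - #S := card_sdiff_of_subset hSA
      have hSle : #S ≤ #A := card_le_card hSA
      -- All `B`-pairs from `S` to `A \ T` lie in `F`, so two subsets of size `s` would contradict
      -- `low`.
      rcases le_or_gt s #(A \ T) with hs' | hs'
      · obtain ⟨S0, hS0, hS0c⟩ := exists_subset_card_eq hs.le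
        obtain ⟨T0, hT0, hT0c⟩ := exists_subset_card_eq hs'
        have h1 := low S0 T0 hS0c hT0c
        have h2 : ∑ u ∈ S0, #{w ∈ T0 | B u w} ≤ ∑ u ∈ S0, K := by
          refine sum_le_sum fun u hu => (card_le_card ?_).trans (hFr u)
          intro w hw
          simp only [mem_filter, mem_univ, true_and] at hw ⊢
          by_contra hF
          have := mem_sdiff.1 (hT0 hw.1)
          exact this.2 (hTmem u (hS0 hu) w this.1 hw.2 hF)
        rw [sum_const, hS0c, smul_eq_mul, mul_comm] at h2
        omega
      -- If `A \ T` is small, the two sides swap roles: the available edges at `A \ T` all go to `A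
      -- \ S`, which is even smaller.
      · have h1 := up #(A \ T) (by omega) hs'.le (A \ S) (A \ T) (by omega) le_rfl
        have h2 : ∑ w ∈ A \ T, d ≤ ∑ w ∈ A \ T, #{u ∈ A \ S | B u w} := by
          refine sum_le_sum fun w hw => (hl' w (mem_sdiff.1 hw).1).trans (card_le_card ?_)
          intro u hu
          simp only [mem_filter, mem_sdiff] at hu hw ⊢
          exact ⟨⟨hu.1, fun h => hw.2 (hTmem u h w hw.1 hu.2.1 hu.2.2)⟩, hu.2.1⟩
        have h3 := sum_card_bipartiteAbove_eq_sum_card_bipartiteBelow B (s := A \ S) (t := A \ T)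
        simp only [bipartiteAbove, bipartiteBelow] at h3
        rw [sum_const, smul_eq_mul, mul_comm, ← h3] at h2
        omega
  obtain ⟨g, hg, hgN⟩ := (Finset.all_card_le_biUnion_card_iff_exists_injective N).1 hall
  refine ⟨fun u => if h : u ∈ A then g ⟨u, h⟩ else u, ?_, ?_⟩
  · intro u hu v hv huv
    simp only [mem_coe] at hu hv
    simp only [hu, hv, dif_pos] at huv
    exact congrArg Subtype.val (hg huv)
  · intro u hu
    simp only [hu, dif_pos]
    exact (mem_filter.1 (hgN ⟨u, hu⟩))

/-- Pairwise disjoint, fixed-point-free perfect matchings of `B` on each of the sets `A i`. -/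
theorem exists_disjoint_matchings_of_pseudorandom {X : Type*} [Fintype X] [DecidableEq X]
    (B : X → X → Prop) [DecidableRel B] (k : ℕ) (A : ℕ → Finset X) (s d : ℕ)
    (hr : ∀ i < k, ∀ u ∈ A i, d + (k + 1) ≤ #{w ∈ A i | B u w})
    (hl : ∀ i < k, ∀ w ∈ A i, d + (k + 1) ≤ #{u ∈ A i | B u w})
    (up : ∀ t, 0 < t → t ≤ s → ∀ S T : Finset X, #S ≤ t → #T ≤ t →
      ∑ u ∈ S, #{w ∈ T | B u w} < d * t)
    (low : ∀ S T : Finset X, #S = s → #T = s → (k + 1) * s < ∑ u ∈ S, #{w ∈ T | B u w}) :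
    ∃ f : ℕ → X → X, ∀ i < k, Set.InjOn (f i) (A i) ∧
      (∀ u ∈ A i, f i u ∈ A i ∧ B u (f i u) ∧ f i u ≠ u) ∧
      ∀ j < i, ∀ u ∈ A i, u ∈ A j → f i u ≠ f j u := by
  classical
  suffices h : ∀ l ≤ k, ∃ f : ℕ → X → X, ∀ i < l, Set.InjOn (f i) (A i) ∧
      (∀ u ∈ A i, f i u ∈ A i ∧ B u (f i u) ∧ f i u ≠ u) ∧
      ∀ j < i, ∀ u ∈ A i, u ∈ A j → f i u ≠ f j u from h k le_rfl
  intro l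
  induction l with
  | zero => exact fun _ => ⟨fun _ => id, fun i hi => absurd hi (Nat.not_lt_zero i)⟩
  | succ l ih =>
    intro hlk
    obtain ⟨f, hf⟩ := ih (by omega)
    -- Forbidding the identity and the at most `k` matchings already built costs at most `k + 1`
    -- pairs at each element, on either side.
    let F : X → X → Prop := fun u w => w = u ∨ ∃ j < l, u ∈ A j ∧ f j u = w
    have hFr : ∀ u, #{w | F u w} ≤ k + 1 := by
      intro u
      have hsub : ({w | F u w} : Finset X) ⊆ insert u ((range l).image fun j => f j u) := by
        intro w
        simp only [mem_filter, mem_univ, true_and, mem_insert, mem_image, mem_range, F]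
        rintro (rfl | ⟨j, hj, -, rfl⟩)
        exacts [Or.inl rfl, Or.inr ⟨j, hj, rfl⟩]
      refine (card_le_card hsub).trans ((card_insert_le _ _).trans ?_)
      have := card_image_le (s := range l) (f := fun j => f j u)
      rw [card_range] at this
      omega
    have hFl : ∀ w, #{u | F u w} ≤ k + 1 := by
      intro w
      have hsub : ({u | F u w} : Finset X) ⊆
          insert w ((range l).biUnion fun j => {u ∈ A j | f j u = w}) := by
        intro u
        simp only [mem_filter, mem_univ, true_and, mem_insert, mem_biUnion, mem_range, F]
        rintro (rfl | ⟨j, hj, h⟩)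
        exacts [Or.inl rfl, Or.inr ⟨j, hj, h⟩]
      refine (card_le_card hsub).trans ((card_insert_le _ _).trans ?_)
      have h1 : #((range l).biUnion fun j => {u ∈ A j | f j u = w}) ≤ #(range l) * 1 := by
        refine card_biUnion_le_card_mul _ _ _ fun j hj => card_le_one.2 ?_
        intro u hu v hv
        rw [mem_filter] at hu hv
        exact (hf j (mem_range.1 hj)).1 hu.1 hv.1 (hu.2.trans hv.2.symm)
      rw [card_range] at h1
      omega
    obtain ⟨g, hg, hgA⟩ := exists_injOn_of_pseudorandom B F (A l) s d (k + 1) hFr hFl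
      (hr l (by omega)) (hl l (by omega)) up low
    refine ⟨Function.update f l g, fun i hi => ?_⟩
    rcases Nat.lt_succ_iff_lt_or_eq.1 hi with hi | rfl
    · have h := hf i hi
      rw [Function.update_of_ne hi.ne]
      refine ⟨h.1, h.2.1, fun j hj => ?_⟩
      rw [Function.update_of_ne (hj.trans hi).ne]
      exact h.2.2 j hj
    · rw [Function.update_self]
      refine ⟨hg, fun u hu => ?_, fun j hj u hu huj => ?_⟩
      · obtain ⟨h1, h2, h3⟩ := hgA u hu
        exact ⟨h1, h2, fun h => h3 (Or.inl h)⟩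
      · rw [Function.update_of_ne hj.ne]
        exact fun h => (hgA u hu).2.2 (Or.inr ⟨j, hj, huj, h.symm⟩)

/-! ### Random proper codes -/

theorem two_mul_card_filter_mem {ι : Type*} [Fintype ι] [DecidableEq ι] (i : ι) :
    2 * #{q : Finset ι | i ∈ q} = 2 ^ Fintype.card ι := by
  have h1 : #{q : Finset ι | i ∈ q} = #{q : Finset ι | i ∉ q} := by
    refine card_bij' (fun q _ => q.erase i) (fun q _ => insert i q) ?_ ?_ ?_ ?_ <;>
      simp +contextual
  have h2 := card_filter_add_card_filter_not (s := (univ : Finset (Finset ι))) (fun q => i ∈ q)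
  rw [card_univ, Fintype.card_finset] at h2
  omega

namespace SimpleGraph

/-- Colorings of `H` by nonempty subsets of `Fin k`. -/
def IsProperCode {X : Type*} (H : SimpleGraph X) {k : ℕ} (x : X → Finset (Fin k)) : Prop :=
  (∀ u, x u ≠ ∅) ∧ ∀ u v, H.Adj u v → x u ≠ x v

variable {X : Type*} [Fintype X] (H : SimpleGraph X) [DecidableRel H.Adj]

/-- The values that a proper code must avoid at `u`, given its values elsewhere. -/
def forbiddenCodes {k : ℕ} (y : X → Finset (Fin k)) (u : X) : Finset (Finset (Fin k)) :=
  insert ∅ ((H.neighborFinset u).image y)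

theorem card_forbiddenCodes_le {k N : ℕ} (hdeg : ∀ u, H.degree u ≤ N) (y : X → Finset (Fin k))
    (u : X) : #(H.forbiddenCodes y u) ≤ N + 1 :=
  (card_insert_le _ _).trans (Nat.succ_le_succ (card_image_le.trans (hdeg u)))

variable [DecidableEq X]

theorem exists_isProperCode {k N : ℕ} (hdeg : ∀ u, H.degree u ≤ N) (hk : N + 1 < 2 ^ k) :
    ∃ x : X → Finset (Fin k), H.IsProperCode x := by
  suffices h : ∀ s : Finset X, ∃ x : X → Finset (Fin k), (∀ u ∈ s, x u ≠ ∅) ∧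
      ∀ u ∈ s, ∀ v ∈ s, H.Adj u v → x u ≠ x v by
    obtain ⟨x, hx, hx'⟩ := h univ
    exact ⟨x, fun u => hx u (mem_univ u), fun u v => hx' u (mem_univ u) v (mem_univ v)⟩
  intro s
  induction s using Finset.induction_on with
  | empty => exact ⟨fun _ => ∅, by simp, by simp⟩
  | insert a s ha ih =>
    obtain ⟨x, hx, hx'⟩ := ih
    obtain ⟨q, hq⟩ : ∃ q, q ∉ H.forbiddenCodes x a := by
      by_contra! hall
      have h1 := card_le_card (fun q _ => hall q : (univ : Finset (Finset (Fin k))) ⊆ _)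
      rw [card_univ, Fintype.card_finset, Fintype.card_fin] at h1
      have := H.card_forbiddenCodes_le hdeg x a
      omega
    simp only [forbiddenCodes, mem_insert, mem_image, mem_neighborFinset, not_or, not_exists,
      not_and] at hq
    have hne : ∀ u ∈ s, u ≠ a := fun u hu h => ha (h ▸ hu)
    refine ⟨Function.update x a q, fun u hu => ?_, fun u hu v hv huv => ?_⟩
    · rcases mem_insert.1 hu with rfl | hu
      · simpa using hq.1
      · rw [Function.update_of_ne (hne u hu)]
        exact hx u hu
    · rcases mem_insert.1 hu with rfl | hus <;> rcases mem_insert.1 hv with rfl | hvs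
      · exact (H.loopless.irrefl _ huv).elim
      · rw [Function.update_self, Function.update_of_ne (hne v hvs)]
        exact fun h => hq.2 v huv h.symm
      · rw [Function.update_self, Function.update_of_ne (hne u hus)]
        exact hq.2 u huv.symm
      · rw [Function.update_of_ne (hne v hvs), Function.update_of_ne (hne u hus)]
        exact hx' u hus v hvs huv

/-- Given its values elsewhere, at least a quarter of the choices for a proper code at `u`
contain `i`. -/
theorem sum_half_le_of_card_compl_le {k N : ℕ} (hk : 4 * (N + 1) ≤ 2 ^ k)
    (L : Finset (Finset (Fin k))) (hL : #Lᶜ ≤ N + 1) (i : Fin k) :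
    ∑ q ∈ L, (if i ∈ q then (1 / 2 : ℝ) else 1) ≤ 7 / 8 * #L := by
  have h1 : #L ≤ 4 * #{q ∈ L | i ∈ q} := by
    have h2 := two_mul_card_filter_mem i
    have h3 : #{q : Finset (Fin k) | i ∈ q} ≤ #{q ∈ L | i ∈ q} + #Lᶜ := by
      refine (card_le_card ?_).trans (card_union_le _ _)
      intro q
      simp only [mem_filter, mem_union, mem_compl, mem_univ, true_and]
      tauto
    have h4 : #L ≤ 2 ^ k := by
      simpa using card_le_univ L
    rw [Fintype.card_fin] at h2
    omega
  -- The weight is 1 minus half the indicator of `i ∈ q`, which gives the average `1 - 1/2 * 1/4 =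
  -- 7/8`.
  have h5 : ∑ q ∈ L, (if i ∈ q then (1 / 2 : ℝ) else 1) =
      ∑ q ∈ L, (1 - 1 / 2 * if i ∈ q then (1 : ℝ) else 0) :=
    sum_congr rfl fun q _ => by split_ifs <;> norm_num
  rw [h5, sum_sub_distrib, ← mul_sum, sum_boole, sum_const, nsmul_eq_mul]
  have h6 : (#L : ℝ) ≤ 4 * #{q ∈ L | i ∈ q} := by exact_mod_cast h1
  linarith

-- Conditioning on all values of the code away from `u` fixes the product over `S`, while the value
-- at `u` stays uniform over the allowed sets; its new factor then averages at most `7/8`.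
open scoped Classical in
theorem sum_isProperCode_prod_insert_le {k N : ℕ} (hdeg : ∀ u, H.degree u ≤ N)
    (hk : 4 * (N + 1) ≤ 2 ^ k) (i : Fin k) (S : Finset X) (u : X) (hu : u ∉ S) :
    ∑ x : X → Finset (Fin k) with H.IsProperCode x,
        ∏ v ∈ insert u S, (if i ∈ x v then (1 / 2 : ℝ) else 1) ≤
      7 / 8 * ∑ x : X → Finset (Fin k) with H.IsProperCode x,
        ∏ v ∈ S, (if i ∈ x v then (1 / 2 : ℝ) else 1) := by
  set Ω : Finset (X → Finset (Fin k)) := {x | H.IsProperCode x} with hΩ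
  let φ : (X → Finset (Fin k)) → (X → Finset (Fin k)) := fun x => Function.update x u ∅
  rw [← sum_fiberwise Ω φ, ← sum_fiberwise Ω φ (fun x => ∏ v ∈ S, _), mul_sum]
  refine sum_le_sum fun y _ => ?_
  by_cases hne : ({x ∈ Ω | φ x = y} : Finset _).Nonempty
  swap
  · rw [not_nonempty_iff_eq_empty] at hne
    simp [hne]
  obtain ⟨x₀, hx₀⟩ := hne
  rw [mem_filter] at hx₀
  obtain ⟨hx₀Ω, rfl⟩ := hx₀
  have hx₀Ω : H.IsProperCode x₀ := by simpa [hΩ] using hx₀Ω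
  let L := (H.forbiddenCodes x₀ u)ᶜ
  have hfib : ({x ∈ Ω | φ x = φ x₀} : Finset _) = L.image (Function.update x₀ u) := by
    ext x
    simp only [mem_filter, mem_image, hΩ, mem_univ, true_and, L, mem_compl, forbiddenCodes,
      mem_insert, mem_neighborFinset, not_or, not_exists, not_and]
    constructor
    · rintro ⟨hx, hφ⟩
      have hag : ∀ v, v ≠ u → x v = x₀ v := by
        intro v hv
        have := congrFun hφ v
        simpa [φ, Function.update_of_ne hv] using this
      refine ⟨x u, ⟨hx.1 u, fun v hv h => ?_⟩, ?_⟩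
      · rw [← hag v hv.ne'] at h
        exact hx.2 u v hv h.symm
      · ext1 v
        by_cases hv : v = u
        · subst hv; simp
        · rw [Function.update_of_ne hv, hag v hv]
    · rintro ⟨q, ⟨hq, hq'⟩, rfl⟩
      refine ⟨⟨fun v => ?_, fun v w hvw => ?_⟩, by simp [φ]⟩
      · by_cases hv : v = u
        · subst hv; simpa using hq
        · rw [Function.update_of_ne hv]; exact hx₀Ω.1 v
      · by_cases hv : v = u
        · subst hv
          rw [Function.update_self, Function.update_of_ne hvw.ne']
          exact fun h => hq' w hvw h.symm
        · by_cases hw : w = u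
          · subst hw
            rw [Function.update_self, Function.update_of_ne hv]
            exact hq' v hvw.symm
          · rw [Function.update_of_ne hv, Function.update_of_ne hw]
            exact hx₀Ω.2 v w hvw
  rw [hfib, sum_image (fun q _ q' _ h => Function.update_injective x₀ u h),
    sum_image (fun q _ q' _ h => Function.update_injective x₀ u h)]
  have hS : ∀ q, ∏ v ∈ S, (if i ∈ Function.update x₀ u q v then (1 / 2 : ℝ) else 1) =
      ∏ v ∈ S, (if i ∈ x₀ v then (1 / 2 : ℝ) else 1) := fun q =>
    prod_congr rfl fun v hv => by
      have hvu : v ≠ u := fun h => hu (h ▸ hv)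
      rw [Function.update_of_ne hvu]
  simp only [prod_insert hu, hS, Function.update_self, sum_const, nsmul_eq_mul]
  rw [← sum_mul, ← mul_assoc]
  refine mul_le_mul_of_nonneg_right ?_ (prod_nonneg fun v _ => by split_ifs <;> norm_num)
  refine sum_half_le_of_card_compl_le hk L ?_ i
  rw [compl_compl]
  exact H.card_forbiddenCodes_le hdeg x₀ u

-- A Chernoff-type bound without independence: one factor `7/8` per element of `S` by induction,
-- then Markov's inequality for `(1/2)` to the number of `u ∈ S` whose code contains `i`.
open scoped Classical in
theorem card_isProperCode_lt_le {k N : ℕ} (hdeg : ∀ u, H.degree u ≤ N)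
    (hk : 4 * (N + 1) ≤ 2 ^ k) (i : Fin k) (S : Finset X) (r : ℕ) :
    (#{x : X → Finset (Fin k) | H.IsProperCode x ∧ #{u ∈ S | i ∈ x u} < r} : ℝ) ≤
      2 ^ r * (7 / 8) ^ #S * #{x : X → Finset (Fin k) | H.IsProperCode x} := by
  have h1 : ∑ x : X → Finset (Fin k) with H.IsProperCode x,
        ∏ v ∈ S, (if i ∈ x v then (1 / 2 : ℝ) else 1) ≤
      (7 / 8) ^ #S * #{x : X → Finset (Fin k) | H.IsProperCode x} := by
    induction S using Finset.induction_on with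
    | empty => simp
    | insert u S hu ih =>
      refine (H.sum_isProperCode_prod_insert_le hdeg hk i S u hu).trans ?_
      rw [card_insert_of_notMem hu, pow_succ]
      linarith
  have h2 : (#{x : X → Finset (Fin k) | H.IsProperCode x ∧ #{u ∈ S | i ∈ x u} < r} : ℝ) *
      (1 / 2) ^ r ≤ ∑ x : X → Finset (Fin k) with H.IsProperCode x,
        ∏ v ∈ S, (if i ∈ x v then (1 / 2 : ℝ) else 1) := by
    rw [← nsmul_eq_mul, ← sum_const]
    refine (sum_le_sum fun x hx => ?_).trans (sum_le_sum_of_subset_of_nonneg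
      (t := {x : X → Finset (Fin k) | H.IsProperCode x}) ?_ ?_)
    · rw [prod_ite, prod_const, prod_const_one, mul_one]
      exact pow_le_pow_of_le_one (by norm_num) (by norm_num) (mem_filter.1 hx).2.2.le
    · intro x
      simp only [mem_filter, mem_univ, true_and]
      exact And.left
    · exact fun x _ _ => prod_nonneg fun v _ => by split_ifs <;> norm_num
  have h3 := h2.trans h1
  have h4 : (2 : ℝ) ^ r * (1 / 2) ^ r = 1 := by rw [← mul_pow]; norm_num
  calc _ = 2 ^ r * ((#{x : X → Finset (Fin k) | H.IsProperCode x ∧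
          #{u ∈ S | i ∈ x u} < r} : ℝ) * (1 / 2) ^ r) := by
        rw [mul_left_comm, h4, mul_one]
    _ ≤ _ := by
        rw [mul_assoc]
        gcongr

/-- A proper code in which every one of the given large sets has many members using any given
symbol. -/
theorem exists_isProperCode_forall_le_card {ι : Type*} [Fintype ι] {k N D r : ℕ}
    (hdeg : ∀ u, H.degree u ≤ N) (hk : 4 * (N + 1) ≤ 2 ^ k) (R : ι → Finset X)
    (hR : ∀ j, D ≤ #(R j)) (hr : Fintype.card ι * k * (2 ^ r * (7 / 8 : ℝ) ^ D) < 1) :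
    ∃ x : X → Finset (Fin k), H.IsProperCode x ∧ ∀ j i, r ≤ #{u ∈ R j | i ∈ x u} := by
  classical
  by_contra! hcon
  set Ω : Finset (X → Finset (Fin k)) := {x | H.IsProperCode x} with hΩ
  obtain ⟨x₀, hx₀⟩ := H.exists_isProperCode (k := k) hdeg (by omega)
  have hpos : (0 : ℝ) < #Ω := by
    exact_mod_cast card_pos.2 ⟨x₀, by simpa [hΩ] using hx₀⟩
  have hsub : Ω ⊆ (univ : Finset (ι × Fin k)).biUnion fun ji =>
      {x : X → Finset (Fin k) | H.IsProperCode x ∧ #{u ∈ R ji.1 | ji.2 ∈ x u} < r} := by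
    intro x hx
    have hx : H.IsProperCode x := by simpa [hΩ] using hx
    obtain ⟨j, i, hji⟩ := hcon x hx
    exact mem_biUnion.2 ⟨(j, i), mem_univ _, by simp [hx, hji]⟩
  have h1 : (#Ω : ℝ) ≤ ∑ ji : ι × Fin k,
      (#{x : X → Finset (Fin k) | H.IsProperCode x ∧ #{u ∈ R ji.1 | ji.2 ∈ x u} < r} : ℝ) := by
    exact_mod_cast (card_le_card hsub).trans card_biUnion_le
  have h2 : ∀ ji ∈ (univ : Finset (ι × Fin k)),
      (#{x : X → Finset (Fin k) | H.IsProperCode x ∧ #{u ∈ R ji.1 | ji.2 ∈ x u} < r} : ℝ) ≤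
        2 ^ r * (7 / 8) ^ D * #Ω := by
    intro ji _
    refine (H.card_isProperCode_lt_le hdeg hk ji.2 (R ji.1) r).trans ?_
    gcongr ?_ * ?_ * _
    exact pow_le_pow_of_le_one (by norm_num) (by norm_num) (hR ji.1)
  have h3 := h1.trans (sum_le_sum h2)
  rw [sum_const, card_univ, Fintype.card_prod, Fintype.card_fin, nsmul_eq_mul, ← mul_assoc] at h3
  push_cast at h3
  nlinarith

end SimpleGraph

/-! ### Contracted pairs and the deterministic coloring theorem -/

namespace SimpleGraph

/-- The graph obtained by contracting the pairs `{a u, b u}`. -/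
def pairGraph {V X : Type*} (G : SimpleGraph V) (a b : X → V) : SimpleGraph X where
  Adj u v := u ≠ v ∧ ∃ p q, (p = a u ∨ p = b u) ∧ (q = a v ∨ q = b v) ∧ G.Adj p q
  symm := ⟨fun _ _ ⟨h, p, q, hp, hq, hpq⟩ => ⟨h.symm, q, p, hq, hp, hpq.symm⟩⟩
  loopless := ⟨fun _ h => h.1 rfl⟩

/-- Each neighbor `v` in the contraction is charged to a neighbor of `a u` or `b u` lying in the
pair of `v`; the pairs are disjoint, so the charging is injective. -/
theorem degree_pairGraph_le {V X : Type*} [Fintype V] [Fintype X] (G : SimpleGraph V)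
    [DecidableRel G.Adj] (a b : X → V) [DecidableRel (G.pairGraph a b).Adj]
    (hab : Function.Injective (Sum.elim a b)) (u : X) :
    (G.pairGraph a b).degree u ≤ G.degree (a u) + G.degree (b u) := by
  classical
  rw [← card_neighborFinset_eq_degree, ← card_neighborFinset_eq_degree,
    ← card_neighborFinset_eq_degree]
  refine le_trans ?_ (card_union_le _ _)
  have hex : ∀ v ∈ (G.pairGraph a b).neighborFinset u, ∃ q ∈ G.neighborFinset (a u) ∪
      G.neighborFinset (b u), q = a v ∨ q = b v := by
    intro v hv
    rw [mem_neighborFinset] at hv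
    obtain ⟨-, p, q, hp, hq, hpq⟩ := hv
    refine ⟨q, ?_, hq⟩
    rw [mem_union, mem_neighborFinset, mem_neighborFinset]
    rcases hp with rfl | rfl
    exacts [Or.inl hpq, Or.inr hpq]
  have : Nonempty V := ⟨a u⟩
  choose! g hg hg' using hex
  refine card_le_card_of_injOn g hg ?_
  intro v hv w hw hvw
  have e1 : ∀ x y, a x = a y → x = y := fun x y h => by
    simpa using @hab (Sum.inl x) (Sum.inl y) h
  have e2 : ∀ x y, b x = b y → x = y := fun x y h => by
    simpa using @hab (Sum.inr x) (Sum.inr y) h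
  have e3 : ∀ x y, a x ≠ b y := fun x y h => by
    simpa using @hab (Sum.inl x) (Sum.inr y) h
  rcases hg' v hv with h1 | h1 <;> rcases hg' w hw with h2 | h2 <;> rw [h1, h2] at hvw
  exacts [e1 _ _ hvw, (e3 _ _ hvw).elim, (e3 _ _ hvw.symm).elim, e2 _ _ hvw]

/-- Conflict-free edge colorings of graphs whose bipartite subgraph between two halves `a`, `b` of
the vertex set is pseudorandom. -/
theorem cfChromaticIndex_le_of_pseudorandom {V X : Type*} [Fintype V] [Fintype X] [DecidableEq X]
    (G : SimpleGraph V) [DecidableRel G.Adj] (a b : X → V)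
    (hab : Function.Injective (Sum.elim a b))
    (hrest : ∀ v w, v ∉ Set.range (Sum.elim a b) → w ∉ Set.range (Sum.elim a b) → v = w)
    {k s d D N : ℕ} (hdeg : ∀ v, G.degree v ≤ N) (hk : 4 * (2 * N + 1) ≤ 2 ^ k)
    (hr : ∀ u, D ≤ #{w | G.Adj (a u) (b w)}) (hl : ∀ w, D ≤ #{u | G.Adj (a u) (b w)})
    (up : ∀ t, 0 < t → t ≤ s → ∀ S T : Finset X, #S ≤ t → #T ≤ t →
      ∑ u ∈ S, #{w ∈ T | G.Adj (a u) (b w)} < d * t)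
    (low : ∀ S T : Finset X, #S = s → #T = s →
      (k + 1) * s < ∑ u ∈ S, #{w ∈ T | G.Adj (a u) (b w)})
    (hD : 2 * Fintype.card X * k * (2 ^ (d + (k + 1)) * (7 / 8 : ℝ) ^ D) < 1) :
    G.cfChromaticIndex ≤ k + 2 := by
  classical
  have e1 : ∀ x y, a x = a y → x = y := fun x y h => by
    simpa using @hab (Sum.inl x) (Sum.inl y) h
  have e2 : ∀ x y, b x = b y → x = y := fun x y h => by
    simpa using @hab (Sum.inr x) (Sum.inr y) h
  have e3 : ∀ x y, a x ≠ b y := fun x y h => by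
    simpa using @hab (Sum.inl x) (Sum.inr y) h
  -- The sets that must meet every symbol often: all neighborhoods across the two halves, from
  -- either side.
  let R : X ⊕ X → Finset X := Sum.elim (fun u => ({w | G.Adj (a u) (b w)} : Finset X))
    (fun w => ({u | G.Adj (a u) (b w)} : Finset X))
  obtain ⟨x, hx, hxR⟩ := (G.pairGraph a b).exists_isProperCode_forall_le_card (k := k)
    (N := 2 * N) (D := D) (r := d + (k + 1))
    (fun u => (G.degree_pairGraph_le a b hab u).trans (by
      have := hdeg (a u); have := hdeg (b u); omega)) hk R
    (by rintro (u | w); exacts [hr u, hl w])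
    (by rw [Fintype.card_sum]; push_cast; convert hD using 3; ring)
  let A : ℕ → Finset X := fun i => {u | ∃ h : i < k, (⟨i, h⟩ : Fin k) ∈ x u}
  have hA : ∀ (i : Fin k) u, u ∈ A i ↔ i ∈ x u := by
    intro i u
    simp [A]
  obtain ⟨f, hf⟩ := exists_disjoint_matchings_of_pseudorandom (fun u w => G.Adj (a u) (b w)) k A s d
    (by
      intro i hi u _
      refine (hxR (Sum.inl u) ⟨i, hi⟩).trans (card_le_card ?_)
      intro w
      simp only [R, Sum.elim_inl, mem_filter, mem_univ, true_and, A]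
      exact fun h => ⟨⟨hi, h.2⟩, h.1⟩)
    (by
      intro i hi u _
      refine (hxR (Sum.inr u) ⟨i, hi⟩).trans (card_le_card ?_)
      intro w
      simp only [R, Sum.elim_inr, mem_filter, mem_univ, true_and, A]
      exact fun h => ⟨⟨hi, h.2⟩, h.1⟩) up low
  -- An injective self-map of a finite set is onto, so the `i`-th matching covers the `b`-side of `A
  -- i` as well as the `a`-side.
  have hsurj : ∀ i < k, ∀ w ∈ A i, ∃ u ∈ A i, f i u = w := fun i hi w hw =>
    surjOn_of_injOn_of_card_le (f i) (fun u hu => ((hf i hi).2.1 u hu).1) (hf i hi).1 le_rfl hw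
  -- The index `none` stands for the pair edges `a u`–`b u`, matched by the identity; the other
  -- matchings avoid them because `f i u ≠ u`.
  let g : Option (Fin k) → X → X := fun o => o.elim id fun i => f i
  let U : Option (Fin k) → Finset X := fun o =>
    o.elim ({u | G.Adj (a u) (b u)} : Finset X) fun i => A i
  have hginj : ∀ o, Set.InjOn (g o) (U o) := by
    rintro (_ | i)
    exacts [fun _ _ _ _ h => h, (hf i i.2).1]
  have hgadj : ∀ o, ∀ u ∈ U o, G.Adj (a u) (b (g o u)) := by
    rintro (_ | i) u hu
    exacts [by simpa [U, g] using hu, ((hf i i.2).2.1 u hu).2.1]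
  have hgdisj : ∀ o o' u, u ∈ U o → u ∈ U o' → g o u = g o' u → o = o' := by
    rintro (_ | i) (_ | j) u hu hu' h
    · rfl
    · exact (((hf j j.2).2.1 u hu').2.2 h.symm).elim
    · exact (((hf i i.2).2.1 u hu).2.2 h).elim
    · rcases lt_trichotomy i j with hij | rfl | hij
      · exact ((hf j j.2).2.2 i hij u hu' hu h.symm).elim
      · rfl
      · exact ((hf i i.2).2.2 j hij u hu hu' h).elim
  let M : Option (Fin k) → V → V → Prop := fun o p q =>
    ∃ u ∈ U o, (p = a u ∧ q = b (g o u)) ∨ (p = b (g o u) ∧ q = a u)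
  have hcov : ∀ (i : Fin k) p u, (p = a u ∨ p = b u) → i ∈ x u →
      ∃ r, G.Adj p r ∧ M (some i) p r := by
    rintro i p u (rfl | rfl) hi
    · have hu := (hA i u).2 hi
      exact ⟨_, hgadj (some i) u hu, u, hu, Or.inl ⟨rfl, rfl⟩⟩
    · obtain ⟨v, hv, rfl⟩ := hsurj i i.2 u ((hA i u).2 hi)
      exact ⟨_, (hgadj (some i) v hv).symm, v, hv, Or.inr ⟨rfl, rfl⟩⟩
  have huncov : ∀ (i : Fin k) p, (∀ u, (p = a u ∨ p = b u) → i ∉ x u) →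
      ∀ r, ¬ M (some i) p r := by
    rintro i p hp r ⟨u, hu, ⟨rfl, -⟩ | ⟨rfl, -⟩⟩
    · exact hp u (Or.inl rfl) ((hA i u).1 hu)
    · exact hp _ (Or.inr rfl) ((hA i _).1 ((hf i i.2).2.1 u hu).1)
  have hidx : ∀ p u v, (p = a u ∨ p = b u) → (p = a v ∨ p = b v) → u = v := by
    rintro p u v (rfl | rfl) (h | h)
    exacts [e1 _ _ h, (e3 _ _ h).elim, (e3 _ _ h.symm).elim, e2 _ _ h]
  have hcase : ∀ p, (∃ u, p = a u ∨ p = b u) ∨ p ∉ Set.range (Sum.elim a b) := by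
    intro p
    by_cases h : p ∈ Set.range (Sum.elim a b)
    · obtain ⟨u | u, rfl⟩ := h
      exacts [Or.inl ⟨u, Or.inl rfl⟩, Or.inl ⟨u, Or.inr rfl⟩]
    · exact Or.inr h
  have hout : ∀ p, p ∉ Set.range (Sum.elim a b) → ∀ u, ¬ (p = a u ∨ p = b u) := by
    rintro p hp u (rfl | rfl)
    exacts [hp ⟨Sum.inl u, rfl⟩, hp ⟨Sum.inr u, rfl⟩]
  have hcard : Fintype.card (Option (Fin k)) + 1 = k + 2 := by simp
  rw [← hcard]
  refine G.cfChromaticIndex_le_of_matchings M ?_ ?_ ?_ ?_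
  · rintro o p q ⟨u, hu, h | h⟩
    exacts [⟨u, hu, Or.inr h.symm⟩, ⟨u, hu, Or.inl h.symm⟩]
  · rintro o p q r ⟨u, hu, ⟨rfl, rfl⟩ | ⟨rfl, rfl⟩⟩ ⟨v, hv, ⟨h, rfl⟩ | ⟨h, rfl⟩⟩
    · rw [e1 _ _ h]
    · exact (e3 _ _ h).elim
    · exact (e3 _ _ h.symm).elim
    · rw [hginj o hu hv (e2 _ _ h)]
  · rintro o o' p q ⟨u, hu, ⟨rfl, rfl⟩ | ⟨rfl, rfl⟩⟩ ⟨v, hv, ⟨h, h'⟩ | ⟨h, h'⟩⟩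
    · obtain rfl := e1 _ _ h
      exact hgdisj o o' u hu hv (e2 _ _ h')
    · exact (e3 _ _ h).elim
    · exact (e3 _ _ h.symm).elim
    · obtain rfl := e1 _ _ h'
      exact hgdisj o o' u hu hv (e2 _ _ h)
  · intro p q hpq
    rcases hcase p with ⟨u, hu⟩ | hp <;> rcases hcase q with ⟨v, hv⟩ | hq
    · by_cases huv : u = v
      · subst huv
        left
        rcases hu with rfl | rfl <;> rcases hv with rfl | rfl
        · exact (G.loopless.irrefl _ hpq).elim
        · exact ⟨none, u, by simpa [U] using hpq, Or.inl ⟨rfl, rfl⟩⟩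
        · exact ⟨none, u, by simpa [U] using hpq.symm, Or.inr ⟨rfl, rfl⟩⟩
        · exact (G.loopless.irrefl _ hpq).elim
      · right
        have hne := hx.2 u v ⟨huv, p, q, hu, hv, hpq⟩
        obtain ⟨i, hi⟩ : ∃ i, ¬ (i ∈ x u ↔ i ∈ x v) := by
          by_contra! h
          exact hne (Finset.ext h)
        refine ⟨some i, ?_⟩
        by_cases hiu : i ∈ x u
        · have hiv : i ∉ x v := fun h => hi ⟨fun _ => h, fun _ => hiu⟩
          exact Or.inl ⟨hcov i p u hu hiu, huncov i q fun w hw => hidx q v w hv hw ▸ hiv⟩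
        · have hiv : i ∈ x v := by_contra fun h => hi ⟨fun h' => (hiu h').elim,
            fun h' => (h h').elim⟩
          exact Or.inr ⟨hcov i q v hv hiv, huncov i p fun w hw => hidx p u w hu hw ▸ hiu⟩
    · obtain ⟨i, hi⟩ := nonempty_iff_ne_empty.2 (hx.1 u)
      exact Or.inr ⟨some i, Or.inl ⟨hcov i p u hu hi,
        huncov i q fun w hw => (hout q hq w hw).elim⟩⟩
    · obtain ⟨i, hi⟩ := nonempty_iff_ne_empty.2 (hx.1 v)
      exact Or.inr ⟨some i, Or.inr ⟨hcov i q v hv hi,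
        huncov i p fun w hw => (hout p hp w hw).elim⟩⟩
    -- At most one vertex lies outside both halves, so no edge has both endpoints there.
    · exact (hpq.ne (hrest p q hp hq)).elim

end SimpleGraph

/-! ### Edge counts in the binomial random graph -/

open MeasureTheory ProbabilityTheory

namespace SimpleGraph

/-- `edgeSet` is injective and measurable, so each set of graphs is the preimage of a finite, hence
measurable, family of edge sets. -/
instance {V : Type*} [Finite V] : DiscreteMeasurableSpace (SimpleGraph V) where
  forall_measurableSet S := by
    rw [← Set.preimage_image_eq S edgeSet_injective]
    exact measurable_edgeSet (Set.Finite.measurableSet (Set.toFinite _))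

-- The generating function of the number of edges in `E` factorizes over the product measure;
-- potential edges outside `E` contribute 1.
open scoped Classical in
theorem integral_binomialRandom_prod {V : Type*} [Fintype V] (p : unitInterval)
    (E : Finset (Sym2 V)) (hE : ∀ e ∈ E, ¬ e.IsDiag) (z : ℝ) :
    ∫ G, ∏ e ∈ E, (if e ∈ edgeSet G then z else 1) ∂(binomialRandom V p) =
      (1 - p + p * z) ^ #E := by
  rw [binomialRandom_eq_map, setBernoulli_eq_map, Measure.infinitePi_eq_pi,
    integral_map (by fun_prop) (by exact AEStronglyMeasurable.of_discrete),
    integral_map (by fun_prop) (by exact AEStronglyMeasurable.of_discrete)]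
  have h1 : ∀ ω : Sym2 V → Prop, ∀ e ∈ E, e ∈ (fromEdgeSet {i | ω i}).edgeSet ↔ ω e := by
    intro ω e he
    simp [hE e he]
  trans ∫ ω : Sym2 V → Prop,
      ∏ e, (fun (e : Sym2 V) (q : Prop) => if e ∈ E ∧ q then z else 1) e (ω e)
      ∂(Measure.pi fun e => unitInterval.toNNReal p • Measure.dirac (e ∈ Sym2.diagSetᶜ) +
        unitInterval.toNNReal (unitInterval.symm p) • Measure.dirac False)
  · refine integral_congr_ae (.of_forall fun ω => ?_)
    have h2 : ∀ e, (if e ∈ E ∧ ω e then z else 1) =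
        if e ∈ E then (if ω e then z else 1) else 1 := fun e => by
      by_cases he : e ∈ E <;> simp [he]
    simp only [h2]
    rw [prod_ite_mem, univ_inter]
    exact prod_congr rfl fun e he => by simp only [h1 ω e he]
  refine (integral_fintype_prod_eq_prod (E := fun _ : Sym2 V => Prop)
    (fun e q => if e ∈ E ∧ q then z else 1)).trans ?_
  have h2 : ∀ e : Sym2 V, ∫ q : Prop, (if e ∈ E ∧ q then z else 1)
      ∂(unitInterval.toNNReal p • Measure.dirac (e ∈ Sym2.diagSetᶜ) +
        unitInterval.toNNReal (unitInterval.symm p) • Measure.dirac False) =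
      if e ∈ E then (1 - p + p * z : ℝ) else 1 := by
    intro e
    rw [integral_add_measure Integrable.of_finite Integrable.of_finite,
      integral_smul_nnreal_measure, integral_smul_nnreal_measure, integral_dirac, integral_dirac]
    by_cases he : e ∈ E
    · have := hE e he
      simp [he, this, NNReal.smul_def]
      ring
    · simp [he, NNReal.smul_def]
  simp_rw [h2]
  rw [prod_ite_mem, univ_inter, prod_const]

variable {V X : Type*} [Fintype V]

/-- The number of pairs in `P` that are edges of `G` between `a` and `b`. -/
noncomputable def crossCount (G : SimpleGraph V) (a b : X → V) (P : Finset (X × X)) : ℕ :=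
  open scoped Classical in #{x ∈ P | G.Adj (a x.1) (b x.2)}

theorem integral_binomialRandom_pow_crossCount (p : unitInterval) (a b : X → V)
    (hab : Function.Injective (Sum.elim a b)) (P : Finset (X × X)) (z : ℝ) :
    ∫ G, z ^ (G.crossCount a b P) ∂(binomialRandom V p) = (1 - p + p * z) ^ #P := by
  classical
  have e1 : ∀ x y, a x = a y → x = y := fun x y h => by
    simpa using @hab (Sum.inl x) (Sum.inl y) h
  have e2 : ∀ x y, b x = b y → x = y := fun x y h => by
    simpa using @hab (Sum.inr x) (Sum.inr y) h
  have e3 : ∀ x y, a x ≠ b y := fun x y h => by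
    simpa using @hab (Sum.inl x) (Sum.inr y) h
  have hinj : Function.Injective fun x : X × X => s(a x.1, b x.2) := by
    rintro ⟨x, y⟩ ⟨x', y'⟩ h
    rcases Sym2.eq_iff.1 h with ⟨h1, h2⟩ | ⟨h1, -⟩
    · exact Prod.ext (e1 _ _ h1) (e2 _ _ h2)
    · exact (e3 _ _ h1).elim
  rw [← card_image_of_injective P hinj, ← integral_binomialRandom_prod p _ _ z]
  · congr 1
    ext1 G
    rw [prod_image (fun _ _ _ _ h => hinj h), prod_ite, prod_const, prod_const_one, mul_one]
    simp only [mem_edgeSet, crossCount]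
  · intro e he
    obtain ⟨x, -, rfl⟩ := mem_image.1 he
    exact fun h => e3 _ _ (Sym2.mk_isDiag_iff.1 h)

/-- Exponential Markov inequality with base `exp (-1)`. Since `1 - exp (-1) ≥ 5/8`, the exponent is
`-(5/8 - 1/2)` times the mean. -/
theorem binomialRandom_crossCount_le (p : unitInterval) (a b : X → V)
    (hab : Function.Injective (Sum.elim a b)) (P : Finset (X × X)) :
    (binomialRandom V p).real {G | (G.crossCount a b P : ℝ) ≤ #P * p / 2} ≤
      Real.exp (-(#P * p / 8)) := by
  have hp0 : (0 : ℝ) ≤ p := p.2.1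
  have h1 := mul_meas_ge_le_integral_of_nonneg (μ := binomialRandom V p)
    (f := fun G => Real.exp (-1) ^ (G.crossCount a b P)) (.of_forall fun G => by positivity)
    Integrable.of_finite (Real.exp (-(#P * p / 2)))
  rw [integral_binomialRandom_pow_crossCount p a b hab] at h1
  have hset : {G : SimpleGraph V | Real.exp (-(#P * p / 2)) ≤
      Real.exp (-1) ^ (G.crossCount a b P)} =
      {G | (G.crossCount a b P : ℝ) ≤ #P * p / 2} := by
    ext G
    rw [Set.mem_ofPred_eq, Set.mem_ofPred_eq, ← Real.exp_nat_mul, Real.exp_le_exp]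
    constructor <;> intro h <;> linarith
  rw [hset] at h1
  have he : Real.exp (-1) ≤ 3 / 8 := by
    rw [Real.exp_neg]
    have := Real.exp_one_gt_d9
    rw [inv_le_comm₀ (by positivity) (by norm_num)]
    norm_num
    linarith
  have h2 : (1 - p + p * Real.exp (-1)) ^ #P ≤ Real.exp (-(5 / 8 * p)) ^ #P := by
    refine pow_le_pow_left₀ ?_ ?_ _
    · have := p.2.2
      have := Real.exp_pos (-1)
      nlinarith
    · refine le_trans ?_ (Real.add_one_le_exp _)
      nlinarith
  have h3 := h1.trans h2
  rw [← Real.exp_nat_mul] at h3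
  calc _ = Real.exp (#P * p / 2) * (Real.exp (-(#P * p / 2)) *
        (binomialRandom V p).real {G | (G.crossCount a b P : ℝ) ≤ #P * p / 2}) := by
        rw [← mul_assoc, ← Real.exp_add]; simp
    _ ≤ Real.exp (#P * p / 2) * Real.exp (#P * -(5 / 8 * p)) := by gcongr
    _ = _ := by rw [← Real.exp_add]; congr 1; ring

/-- Exponential Markov inequality with base `exp 1`, using `exp 1 - 1 ≤ 2`. -/
theorem binomialRandom_le_crossCount (p : unitInterval) (a b : X → V)
    (hab : Function.Injective (Sum.elim a b)) (P : Finset (X × X)) (y : ℝ) :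
    (binomialRandom V p).real {G | y ≤ (G.crossCount a b P : ℝ)} ≤
      Real.exp (2 * p * #P - y) := by
  have hp0 : (0 : ℝ) ≤ p := p.2.1
  have h1 := mul_meas_ge_le_integral_of_nonneg (μ := binomialRandom V p)
    (f := fun G => Real.exp 1 ^ (G.crossCount a b P)) (.of_forall fun G => by positivity)
    Integrable.of_finite (Real.exp y)
  rw [integral_binomialRandom_pow_crossCount p a b hab] at h1
  have hset : {G : SimpleGraph V | Real.exp y ≤ Real.exp 1 ^ (G.crossCount a b P)} =
      {G | y ≤ (G.crossCount a b P : ℝ)} := by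
    ext G
    rw [Set.mem_ofPred_eq, Set.mem_ofPred_eq, ← Real.exp_nat_mul, Real.exp_le_exp, mul_one]
  rw [hset] at h1
  have h2 : (1 - p + p * Real.exp 1) ^ #P ≤ Real.exp (2 * p) ^ #P := by
    have := Real.exp_one_lt_d9
    have := Real.exp_one_gt_d9
    refine pow_le_pow_left₀ ?_ ?_ _
    · nlinarith
    · refine le_trans ?_ (Real.add_one_le_exp _)
      nlinarith
  have h3 := h1.trans h2
  rw [← Real.exp_nat_mul] at h3
  calc _ = Real.exp (-y) * (Real.exp y *
        (binomialRandom V p).real {G | y ≤ (G.crossCount a b P : ℝ)}) := by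
        rw [← mul_assoc, ← Real.exp_add]; simp
    _ ≤ Real.exp (-y) * Real.exp (#P * (2 * p)) := by gcongr
    _ = _ := by rw [← Real.exp_add]; congr 1; ring

end SimpleGraph

/-! ### Pseudorandomness between the two halves -/

namespace SimpleGraph

variable {V X : Type*}

theorem crossCount_eq_sum (G : SimpleGraph V) [DecidableRel G.Adj] (a b : X → V)
    (S T : Finset X) :
    G.crossCount a b (S ×ˢ T) = ∑ u ∈ S, #{w ∈ T | G.Adj (a u) (b w)} := by
  classical
  simp only [crossCount, card_filter, sum_product]
  congr!

theorem crossCount_mono (G : SimpleGraph V) (a b : X → V) {P Q : Finset (X × X)} (h : P ⊆ Q) :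
    G.crossCount a b P ≤ G.crossCount a b Q := by
  classical
  exact card_le_card (filter_subset_filter _ h)

/-- Between the two sides `a` and `b`, all degrees and all edge counts between sets of size `s` are
at least half of what is expected at density `p`, and no two sets of equal size at most `s` span
many edges. -/
structure IsCrossPseudorandom [Fintype X] (G : SimpleGraph V) (a b : X → V) (p : ℝ) (s : ℕ) :
    Prop where
  row : ∀ u, Fintype.card X * p / 2 < G.crossCount a b ({u} ×ˢ univ)
  col : ∀ w, Fintype.card X * p / 2 < G.crossCount a b (univ ×ˢ {w})
  low : ∀ S T : Finset X, #S = s → #T = s → (s * s * p / 2 : ℝ) < G.crossCount a b (S ×ˢ T)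
  up : ∀ t ∈ Icc 1 s, ∀ S T : Finset X, #S = t → #T = t →
    (G.crossCount a b (S ×ˢ T) : ℝ) < t * (Fintype.card X * p) / 50

/-- A union bound over vertices and pairs of sets: at most `4 ^ m` pairs for `low` and `m ^ (2 * t)`
for `up`, where `m` is the size of a half. As `200 * t ≤ m`, twice the mean `t * t * p` is at most
half the threshold in `up`. -/
theorem binomialRandom_not_isCrossPseudorandom_le [Fintype V] [Fintype X] (p : unitInterval)
    (a b : X → V) (hab : Function.Injective (Sum.elim a b)) (s : ℕ)
    (hs : 200 * s ≤ Fintype.card X) :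
    (binomialRandom V p).real {G | ¬ G.IsCrossPseudorandom a b p s} ≤
      2 * Fintype.card X * Real.exp (-(Fintype.card X * p / 8)) +
      4 ^ Fintype.card X * Real.exp (-(s * s * p / 8)) +
      ∑ t ∈ Icc 1 s, (Fintype.card X : ℝ) ^ (2 * t) *
        Real.exp (-(t * (Fintype.card X * p) / 100)) := by
  classical
  set m := Fintype.card X with hm
  have hp0 : (0 : ℝ) ≤ p := p.2.1
  set μ := binomialRandom V p with hμ
  let ER : X → Set (SimpleGraph V) := fun u =>
    {G | (G.crossCount a b ({u} ×ˢ univ) : ℝ) ≤ m * p / 2}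
  let EC : X → Set (SimpleGraph V) := fun w =>
    {G | (G.crossCount a b (univ ×ˢ {w}) : ℝ) ≤ m * p / 2}
  let Q : ℕ → Finset (Finset X × Finset X) := fun t =>
    powersetCard t univ ×ˢ powersetCard t univ
  let EL : Finset X × Finset X → Set (SimpleGraph V) := fun ST =>
    {G | (G.crossCount a b (ST.1 ×ˢ ST.2) : ℝ) ≤ s * s * p / 2}
  let EU : ℕ → Finset X × Finset X → Set (SimpleGraph V) := fun t ST =>
    {G | (t * (m * p) / 50 : ℝ) ≤ G.crossCount a b (ST.1 ×ˢ ST.2)}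
  have hsub : {G | ¬ G.IsCrossPseudorandom a b p s} ⊆
      (((⋃ u ∈ (univ : Finset X), ER u) ∪ ⋃ w ∈ (univ : Finset X), EC w) ∪
        ⋃ ST ∈ Q s, EL ST) ∪ ⋃ t ∈ Icc 1 s, ⋃ ST ∈ Q t, EU t ST := by
    intro G hG
    by_contra hcon
    simp only [Set.mem_union, Set.mem_iUnion, not_or, not_exists] at hcon
    obtain ⟨⟨⟨h1, h2⟩, h3⟩, h4⟩ := hcon
    refine hG ⟨fun u => not_le.1 (h1 u (mem_univ u)), fun w => not_le.1 (h2 w (mem_univ w)),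
      fun S T hS hT => not_le.1 (h3 (S, T) ?_), fun t ht S T hS hT => not_le.1 (h4 t ht (S, T) ?_)⟩
    · simp [Q, hS, hT]
    · simp [Q, hS, hT]
  have hQ : ∀ t, (#(Q t) : ℝ) = m.choose t * m.choose t := by
    intro t
    simp [Q, hm]
  have hR : μ.real (⋃ u ∈ (univ : Finset X), ER u) ≤ m * Real.exp (-(m * p / 8)) := by
    refine (measureReal_biUnion_finset_le _ _).trans ?_
    refine (sum_le_card_nsmul _ _ (Real.exp (-(m * p / 8))) fun u _ => ?_).trans_eq
      (by rw [nsmul_eq_mul, card_univ])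
    have := binomialRandom_crossCount_le p a b hab ({u} ×ˢ univ)
    rwa [card_product, card_singleton, one_mul, card_univ] at this
  have hC : μ.real (⋃ u ∈ (univ : Finset X), EC u) ≤ m * Real.exp (-(m * p / 8)) := by
    refine (measureReal_biUnion_finset_le _ _).trans ?_
    refine (sum_le_card_nsmul _ _ (Real.exp (-(m * p / 8))) fun u _ => ?_).trans_eq
      (by rw [nsmul_eq_mul, card_univ])
    have := binomialRandom_crossCount_le p a b hab (univ ×ˢ {u})
    rwa [card_product, card_singleton, mul_one, card_univ] at this
  have hL : μ.real (⋃ ST ∈ Q s, EL ST) ≤ 4 ^ m * Real.exp (-(s * s * p / 8)) := by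
    refine (measureReal_biUnion_finset_le _ _).trans ?_
    refine (sum_le_card_nsmul _ _ (Real.exp (-(s * s * p / 8))) fun ST hST => ?_).trans ?_
    · have := binomialRandom_crossCount_le p a b hab (ST.1 ×ˢ ST.2)
      simp only [Q, mem_product, mem_powersetCard] at hST
      rw [card_product, hST.1.2, hST.2.2] at this
      rwa [Nat.cast_mul] at this
    · rw [nsmul_eq_mul, hQ]
      gcongr
      have h1 : (m.choose s : ℝ) ≤ 2 ^ m := by exact_mod_cast Nat.choose_le_two_pow m s
      calc (m.choose s * m.choose s : ℝ) ≤ 2 ^ m * 2 ^ m := by gcongr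
        _ = 4 ^ m := by rw [← mul_pow]; norm_num
  have hU : μ.real (⋃ t ∈ Icc 1 s, ⋃ ST ∈ Q t, EU t ST) ≤
      ∑ t ∈ Icc 1 s, (m : ℝ) ^ (2 * t) * Real.exp (-(t * (m * p) / 100)) := by
    refine (measureReal_biUnion_finset_le _ _).trans (sum_le_sum fun t ht => ?_)
    refine (measureReal_biUnion_finset_le _ _).trans ?_
    refine (sum_le_card_nsmul _ _ (Real.exp (-(t * (m * p) / 100))) fun ST hST => ?_).trans ?_
    · refine (binomialRandom_le_crossCount p a b hab (ST.1 ×ˢ ST.2) _).trans ?_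
      simp only [Q, mem_product, mem_powersetCard] at hST
      rw [card_product, hST.1.2, hST.2.2, Real.exp_le_exp]
      have h1 : (200 * t : ℝ) ≤ m := by
        have := (mem_Icc.1 ht).2
        exact_mod_cast (by omega : 200 * t ≤ m)
      have h2 : (p * t * (200 * t) : ℝ) ≤ p * t * m := by gcongr
      push_cast
      linarith
    · rw [nsmul_eq_mul, hQ]
      gcongr
      have h1 : (m.choose t : ℝ) ≤ m ^ t := by exact_mod_cast Nat.choose_le_pow m t
      calc (m.choose t * m.choose t : ℝ) ≤ m ^ t * m ^ t := by gcongr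
        _ = m ^ (2 * t) := by rw [← pow_add, two_mul]
  calc _ ≤ μ.real _ := measureReal_mono hsub
    _ ≤ ((μ.real _ + μ.real _) + μ.real _) + μ.real _ :=
      (measureReal_union_le _ _).trans (add_le_add_left ((measureReal_union_le _ _).trans
        (add_le_add_left (measureReal_union_le _ _) _)) _)
    _ ≤ _ := by linarith

theorem IsCrossPseudorandom.cfChromaticIndex_le [Fintype V] [Fintype X] {G : SimpleGraph V}
    {a b : X → V} {p : ℝ} {s : ℕ} (hG : G.IsCrossPseudorandom a b p s)
    (hab : Function.Injective (Sum.elim a b))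
    (hrest : ∀ v w, v ∉ Set.range (Sum.elim a b) → w ∉ Set.range (Sum.elim a b) → v = w)
    {k r : ℕ} (hk : 4 * (2 * G.maxDeg + 1) ≤ 2 ^ k) (hs : s ≤ Fintype.card X)
    (hr : r = ⌊Fintype.card X * p / 20⌋₊) (hL : 100 ≤ Fintype.card X * p)
    (hkr : 2 * (k + 1) ≤ r) (hks : 2 * (k + 1) ≤ s * p)
    (hD : 2 * Fintype.card X * k * (3 / 5 : ℝ) ^ r < 1) :
    G.cfChromaticIndex ≤ k + 2 := by
  classical
  set m := Fintype.card X with hm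
  have hr1 : (r : ℝ) ≤ m * p / 20 := hr ▸ Nat.floor_le (by linarith)
  have hr2 : m * p / 20 < r + 1 := hr ▸ Nat.lt_floor_add_one _
  have hd : (t : ℝ) → 0 ≤ t → t * (m * p) / 50 ≤ (r - (k + 1) : ℕ) * t := by
    intro t ht
    have h1 : (2 * (k + 1) : ℝ) ≤ r := by exact_mod_cast hkr
    rw [Nat.cast_sub (by omega)]
    push_cast
    -- Here `r - (k + 1) ≥ r / 2 > m * p / 40 - 1 / 2`, and `m * p ≥ 100` absorbs the rounding.
    have h2 : m * p / 50 ≤ (r - (k + 1) : ℝ) := by linarith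
    nlinarith
  refine G.cfChromaticIndex_le_of_pseudorandom a b hab hrest (k := k) (s := s)
    (d := r - (k + 1)) (D := 10 * r) (N := G.maxDeg) (fun v => ?_) hk (fun u => ?_) (fun w => ?_)
    ?_ ?_ ?_
  · unfold maxDeg
    convert G.degree_le_maxDegree v
  · have h1 := hG.row u
    rw [crossCount_eq_sum, sum_singleton] at h1
    have h2 : ((10 * r : ℕ) : ℝ) < #{w | G.Adj (a u) (b w)} := by
      push_cast
      linarith
    exact_mod_cast h2.le
  · have h1 := hG.col w
    rw [crossCount_eq_sum] at h1
    have h3 : ∑ u, #{w' ∈ ({w} : Finset X) | G.Adj (a u) (b w')} = #{u | G.Adj (a u) (b w)} := by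
      rw [card_filter]
      refine sum_congr rfl fun u _ => ?_
      rw [filter_singleton]
      split_ifs <;> simp
    rw [h3] at h1
    have h2 : ((10 * r : ℕ) : ℝ) < #{u | G.Adj (a u) (b w)} := by
      push_cast
      linarith
    exact_mod_cast h2.le
  · intro t ht hts S T hS hT
    -- `up` speaks of sets of size exactly `t`; smaller sets are enlarged, which only adds edges.
    obtain ⟨S', hS', hS'c⟩ := exists_superset_card_eq hS (hts.trans hs)
    obtain ⟨T', hT', hT'c⟩ := exists_superset_card_eq hT (hts.trans hs)
    have h1 := hG.up t (mem_Icc.2 ⟨ht, hts⟩) S' T' hS'c hT'c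
    have h2 := G.crossCount_mono a b (product_subset_product hS' hT')
    rw [← crossCount_eq_sum G a b S T]
    have h3 := h1.trans_le (hd t (by positivity))
    exact h2.trans_lt (by exact_mod_cast h3)
  · intro S T hS hT
    have h1 := hG.low S T hS hT
    rw [← crossCount_eq_sum G a b S T]
    have h2 : ((k + 1) * s : ℝ) ≤ s * s * p / 2 := by
      have : (0 : ℝ) ≤ s := by positivity
      nlinarith
    exact_mod_cast h2.trans_lt h1
  -- Degrees are at least `10 * r` and `r` of them must survive; the base is `2 * (7/8) ^ 10 ≤ 3/5`.
  · rw [Nat.sub_add_cancel (by omega), pow_mul, ← mul_pow]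
    refine lt_of_le_of_lt ?_ hD
    gcongr
    norm_num

end SimpleGraph

/-! ### The halves of `Fin n` and explicit estimates -/

/-- The first of two disjoint halves of `Fin n`; for odd `n` the last element is in neither. -/
def finLowerHalf (n : ℕ) (u : Fin (n / 2)) : Fin n := ⟨u, by omega⟩

/-- The second of two disjoint halves of `Fin n`. -/
def finUpperHalf (n : ℕ) (u : Fin (n / 2)) : Fin n := ⟨n / 2 + u, by omega⟩

theorem injective_sumElim_finHalves (n : ℕ) :
    Function.Injective (Sum.elim (finLowerHalf n) (finUpperHalf n)) := by
  rintro (u | u) (v | v) h <;>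
    simp only [Sum.elim_inl, Sum.elim_inr, finLowerHalf, finUpperHalf, Fin.mk.injEq] at h
  · rw [Fin.ext h]
  · omega
  · omega
  · rw [Fin.ext (by omega : (u : ℕ) = v)]

theorem eq_of_notMem_finHalves {n : ℕ} (v w : Fin n)
    (hv : v ∉ Set.range (Sum.elim (finLowerHalf n) (finUpperHalf n)))
    (hw : w ∉ Set.range (Sum.elim (finLowerHalf n) (finUpperHalf n))) : v = w := by
  have key : ∀ x : Fin n, x ∉ Set.range (Sum.elim (finLowerHalf n) (finUpperHalf n)) →
      (x : ℕ) = 2 * (n / 2) := by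
    intro x hx
    by_contra hne
    rcases lt_or_ge (x : ℕ) (n / 2) with h | h
    · exact hx ⟨Sum.inl ⟨x, h⟩, rfl⟩
    · exact hx ⟨Sum.inr ⟨x - n / 2, by omega⟩, Fin.ext (by simp [finUpperHalf]; omega)⟩
  exact Fin.ext ((key v hv).trans (key w hw).symm)

namespace SimpleGraph

/-- Bounds `Δ` below by a quantity depending only on `n` and `p`, so that the error term `η` can be
chosen independently of the graph. -/
theorem IsCrossPseudorandom.lt_maxDeg {V X : Type*} [Fintype V] [Fintype X] [Nonempty X]
    {G : SimpleGraph V} {a b : X → V} {p : ℝ} {s : ℕ} (hG : G.IsCrossPseudorandom a b p s)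
    (hab : Function.Injective (Sum.elim a b)) : Fintype.card X * p / 2 < G.maxDeg := by
  classical
  obtain ⟨u⟩ := ‹Nonempty X›
  refine (hG.row u).trans_le ?_
  rw [crossCount_eq_sum, sum_singleton]
  have h1 : #{w | G.Adj (a u) (b w)} ≤ G.degree (a u) := by
    rw [← card_neighborFinset_eq_degree]
    refine card_le_card_of_injOn b (fun w hw => ?_) fun x _ y _ h => ?_
    · simpa using hw
    · simpa using @hab (Sum.inr x) (Sum.inr y) h
  have h2 : G.degree (a u) ≤ G.maxDeg := by
    unfold maxDeg
    convert G.degree_le_maxDegree (a u)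
  exact_mod_cast h1.trans h2

theorem maxDeg_le {n : ℕ} (G : SimpleGraph (Fin n)) : G.maxDeg ≤ n := by
  classical
  unfold maxDeg
  refine G.maxDegree_le_of_forall_degree_le _ fun v => ?_
  simpa using (G.degree_lt_card_verts v).le

theorem exists_two_pow_between (N : ℕ) (hN : 1 ≤ N) :
    ∃ k : ℕ, 4 * (2 * N + 1) ≤ 2 ^ k ∧ (k : ℝ) ≤ Real.logb 2 N + 5 := by
  refine ⟨Nat.clog 2 (4 * (2 * N + 1)), Nat.le_pow_clog (by norm_num) _, ?_⟩
  set k := Nat.clog 2 (4 * (2 * N + 1)) with hk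
  have h1 : 2 ^ (k - 1) < 4 * (2 * N + 1) := by
    have := Nat.pow_pred_clog_lt_self (b := 2) (by norm_num) (by omega : 1 < 4 * (2 * N + 1))
    rwa [← hk] at this
  have h2 : 1 ≤ k := Nat.clog_pos (by norm_num) (by omega)
  -- The factor 32 is the source of the additive 5; the two extra colors raise it to 7.
  have h3 : 2 ^ k ≤ 32 * N := by
    obtain ⟨j, hj⟩ := Nat.exists_eq_add_of_le' h2
    rw [hj, Nat.add_sub_cancel] at h1
    rw [hj, pow_succ]
    omega
  have hN' : (0 : ℝ) < N := by exact_mod_cast hN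
  have h4 : ((2 : ℝ) ^ (k : ℝ)) ≤ 2 ^ (5 : ℝ) * N := by
    rw [Real.rpow_natCast]
    norm_num
    exact_mod_cast h3
  have h5 := Real.logb_le_logb_of_le (b := 2) (by norm_num) (by positivity) h4
  rw [Real.logb_rpow (by norm_num) (by norm_num), Real.logb_mul (by positivity) hN'.ne',
    Real.logb_rpow (by norm_num) (by norm_num)] at h5
  linarith

theorem logb_two_le_two_mul_log {x : ℝ} (hx : 1 ≤ x) : Real.logb 2 x ≤ 2 * Real.log x := by
  have h1 := Real.log_two_gt_d9
  have h2 := Real.log_nonneg hx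
  rw [Real.logb, div_le_iff₀ (by linarith)]
  nlinarith

theorem logb_two_le_three_mul_sqrt {x : ℝ} (hx : 0 < x) : Real.logb 2 x ≤ 3 * √x := by
  have h1 := Real.log_two_gt_d9
  have h2 : Real.log x = 2 * Real.log (√x) := by
    rw [Real.log_sqrt hx.le]
    ring
  have h3 := Real.log_le_sub_one_of_pos (Real.sqrt_pos.2 hx)
  have h4 := Real.sqrt_nonneg x
  rw [Real.logb, div_le_iff₀ (by linarith), h2]
  nlinarith

theorem half_bounds {n : ℕ} {p : ℝ} (hp : 0 ≤ p) (hn : 1000 ≤ n) :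
    (n : ℝ) ≤ 3 * (n / 2 : ℕ) ∧ 2 * ((n / 2 : ℕ) : ℝ) ≤ n ∧
      ((n / 2 : ℕ) : ℝ) ≤ 400 * (n / 2 / 200 : ℕ) ∧
      (n / 2 : ℕ) * p ≤ 400 * ((n / 2 / 200 : ℕ) * p) := by
  have h3 : ((n / 2 : ℕ) : ℝ) ≤ 400 * (n / 2 / 200 : ℕ) := by
    exact_mod_cast (by omega : n / 2 ≤ 400 * (n / 2 / 200))
  refine ⟨by exact_mod_cast (by omega : n ≤ 3 * (n / 2)),
    by exact_mod_cast (by omega : 2 * (n / 2) ≤ n), h3, ?_⟩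
  rw [← mul_assoc]
  exact mul_le_mul_of_nonneg_right h3 hp

theorem exp_neg_two_mul_log {x : ℝ} (hx : 0 < x) :
    Real.exp (-(2 * Real.log x)) = 1 / x * (1 / x) := by
  rw [show -(2 * Real.log x) = -Real.log x + -Real.log x by ring, Real.exp_add, Real.exp_neg,
    Real.exp_log hx, one_div]

theorem binomialRandom_not_isCrossPseudorandom_le_three_div {n : ℕ} (p : unitInterval)
    (hn : 1000 ≤ n) (hL : 10 ^ 7 * (Real.log n + 1) ≤ (n / 2 : ℕ) * (p : ℝ)) :
    (binomialRandom (Fin n) p).real {G | ¬ G.IsCrossPseudorandom (finLowerHalf n)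
      (finUpperHalf n) p (n / 2 / 200)} ≤ 3 / n := by
  have hp0 : (0 : ℝ) ≤ p := p.2.1
  have hn' : (1000 : ℝ) ≤ n := by exact_mod_cast hn
  obtain ⟨hm1, hm2, hs1, hs2⟩ := half_bounds hp0 hn
  have hlog : 0 ≤ Real.log n := Real.log_nonneg (by linarith)
  refine (binomialRandom_not_isCrossPseudorandom_le p _ _ (injective_sumElim_finHalves n)
    (n / 2 / 200) (by rw [Fintype.card_fin]; omega)).trans ?_
  rw [Fintype.card_fin]
  set m : ℕ := n / 2 with hm
  set s : ℕ := m / 200 with hs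
  have hm0 : (0 : ℝ) ≤ m := by positivity
  have hs0 : (0 : ℝ) ≤ s := by positivity
  have hlogn : Real.exp (-(2 * Real.log n)) = 1 / n * (1 / n) := exp_neg_two_mul_log (by linarith)
  have t1 : 2 * m * Real.exp (-(m * p / 8)) ≤ 1 / n := by
    calc 2 * m * Real.exp (-(m * p / 8)) ≤ n * Real.exp (-(2 * Real.log n)) := by
          gcongr
          linarith
      _ = 1 / n := by rw [hlogn]; field_simp
  have t2 : 4 ^ m * Real.exp (-(s * s * p / 8)) ≤ 1 / n := by
    have h4 : (4 : ℝ) ≤ Real.exp 2 := by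
      have := Real.exp_one_gt_d9
      rw [show (2 : ℝ) = 1 + 1 by norm_num, Real.exp_add]
      nlinarith
    -- Since `s ≥ m / 400` and `m * p ≥ 10 ^ 7`, the product `s * s * p` is at least `62.5 * m`,
    -- which beats the `4 ^ m` pairs of sets.
    have h5 : 56 * (m : ℝ) ≤ s * s * p := by
      have h6 : (m : ℝ) * (m * p) ≤ 400 * s * (400 * (s * p)) := by gcongr
      have h7 : (m : ℝ) * 10 ^ 7 ≤ m * (m * p) := by
        refine mul_le_mul_of_nonneg_left ?_ hm0
        linarith
      linarith
    calc (4 : ℝ) ^ m * Real.exp (-(s * s * p / 8)) ≤ Real.exp 2 ^ m * Real.exp (-(7 * m)) := by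
          gcongr
          linarith
      _ = Real.exp (-(5 * m)) := by rw [← Real.exp_nat_mul, ← Real.exp_add]; congr 1; ring
      _ ≤ Real.exp (-Real.log n) := by
          have := Real.log_le_sub_one_of_pos (by linarith : (0 : ℝ) < n)
          gcongr
          linarith
      _ = 1 / n := by rw [Real.exp_neg, Real.exp_log (by linarith), one_div]
  have t3 : ∑ t ∈ Icc 1 s, (m : ℝ) ^ (2 * t) * Real.exp (-(t * (m * p) / 100)) ≤ 1 / n := by
    have h1 : ∀ t ∈ Icc 1 s, (m : ℝ) ^ (2 * t) * Real.exp (-(t * (m * p) / 100)) ≤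
        1 / n * (1 / n) := by
      intro t ht
      have ht1 : (1 : ℝ) ≤ t := by exact_mod_cast (mem_Icc.1 ht).1
      have h2 : (m : ℝ) ≤ Real.exp (Real.log n) := by
        rw [Real.exp_log (by linarith)]
        linarith
      calc (m : ℝ) ^ (2 * t) * Real.exp (-(t * (m * p) / 100))
          ≤ Real.exp (Real.log n) ^ (2 * t) * Real.exp (-(t * (4 * Real.log n))) := by
            gcongr
            rw [mul_div_assoc]
            gcongr
            linarith
        _ = Real.exp (-(2 * (t * Real.log n))) := by
            rw [← Real.exp_nat_mul, ← Real.exp_add]; push_cast; congr 1; ring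
        _ ≤ Real.exp (-(2 * Real.log n)) := by
            gcongr
            nlinarith
        _ = _ := hlogn
    refine (sum_le_card_nsmul _ _ _ h1).trans ?_
    rw [nsmul_eq_mul, Nat.card_Icc, Nat.add_sub_cancel]
    have h3 : (s : ℝ) ≤ n := by exact_mod_cast (by omega : s ≤ n)
    calc (s : ℝ) * (1 / n * (1 / n)) ≤ n * (1 / n * (1 / n)) := by gcongr
      _ = 1 / n := by field_simp
  calc _ ≤ (1 / n + 1 / n + 1 / n : ℝ) := by gcongr
    _ = 3 / n := by ring

theorem IsCrossPseudorandom.cfChromaticIndex_le_logb {n : ℕ} {p : ℝ} (hp : 0 ≤ p)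
    (hn : 1000 ≤ n) (hL : 10 ^ 7 * (Real.log n + 1) ≤ (n / 2 : ℕ) * p) {G : SimpleGraph (Fin n)}
    (hG : G.IsCrossPseudorandom (finLowerHalf n) (finUpperHalf n) p (n / 2 / 200)) :
    (G.cfChromaticIndex : ℝ) ≤ Real.logb 2 G.maxDeg + 7 := by
  have hn' : (1000 : ℝ) ≤ n := by exact_mod_cast hn
  obtain ⟨hm1, hm2, hs1, hs2⟩ := half_bounds hp hn
  have hlog : 0 ≤ Real.log n := Real.log_nonneg (by linarith)
  have hne : Nonempty (Fin (n / 2)) := ⟨⟨0, by omega⟩⟩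
  have hΔ := hG.lt_maxDeg (injective_sumElim_finHalves n)
  rw [Fintype.card_fin] at hΔ
  have hΔ1 : (1 : ℝ) ≤ G.maxDeg := by linarith
  obtain ⟨k, hk, hk'⟩ := exists_two_pow_between G.maxDeg (by exact_mod_cast hΔ1)
  have hkn : (k : ℝ) + 1 ≤ 6 * (Real.log n + 1) := by
    have h1 : Real.logb 2 G.maxDeg ≤ Real.logb 2 n :=
      Real.logb_le_logb_of_le (by norm_num) (by linarith) (by exact_mod_cast G.maxDeg_le)
    have h2 := logb_two_le_two_mul_log (x := n) (by linarith)
    linarith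
  have hr2 := Nat.lt_floor_add_one ((n / 2 : ℕ) * p / 20)
  set r := ⌊(n / 2 : ℕ) * p / 20⌋₊ with hr
  have hcf : G.cfChromaticIndex ≤ k + 2 := by
    refine hG.cfChromaticIndex_le (injective_sumElim_finHalves n) eq_of_notMem_finHalves hk
      (by rw [Fintype.card_fin]; omega) (r := r) (by rw [Fintype.card_fin])
      (by rw [Fintype.card_fin]; linarith) ?_ (by linarith) ?_
    · have : (2 * (k + 1) : ℝ) ≤ r := by linarith
      exact_mod_cast this
    · rw [Fintype.card_fin]
      -- From `1 - 2/5 ≤ exp (-(2/5))`; as `r` is a large multiple of `log n + 1`, this power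
      -- outweighs the factor of order `n ^ 2`.
      have h1 : (3 / 5 : ℝ) ^ r ≤ Real.exp (-(2 / 5)) ^ r := by
        refine pow_le_pow_left₀ (by norm_num) ?_ _
        have := Real.add_one_le_exp (-(2 / 5) : ℝ)
        linarith
      rw [← Real.exp_nat_mul] at h1
      have h2 : Real.exp (r * -(2 / 5)) ≤ Real.exp (-(2 * Real.log n)) * Real.exp (-12) := by
        rw [← Real.exp_add, Real.exp_le_exp]
        linarith
      rw [exp_neg_two_mul_log (by linarith)] at h2
      have h3 : Real.exp (-12) < 1 / 12 := by
        rw [Real.exp_neg, inv_lt_comm₀ (Real.exp_pos _) (by norm_num)]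
        have := Real.add_one_lt_exp (x := 12) (by norm_num)
        norm_num
        linarith
      have h4 : (k : ℝ) ≤ 12 * n := by
        have := Real.log_le_sub_one_of_pos (by linarith : (0 : ℝ) < n)
        linarith
      calc 2 * ((n / 2 : ℕ) : ℝ) * k * (3 / 5 : ℝ) ^ r
          ≤ n * (12 * n) * (1 / n * (1 / n) * Real.exp (-12)) := by
            gcongr
            exact h1.trans h2
        _ = 12 * Real.exp (-12) := by field_simp
        _ < 1 := by linarith
  have : (G.cfChromaticIndex : ℝ) ≤ k + 2 := by exact_mod_cast hcf
  linarith

end SimpleGraph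

/-! ### Asymptotics and the final statement -/

open Filter Topology

namespace SimpleGraph

/-- `n * p` eventually dominates `n ^ (1 - ε)`, which outgrows every multiple of `log n`. -/
theorem eventually_mul_log_add_one_le {ε : ℝ} (hε : ε < 1) {p : ℕ → unitInterval}
    (hp : (fun n : ℕ => (n : ℝ) ^ (-ε)) =o[atTop] fun n : ℕ => (p n : ℝ)) :
    ∀ᶠ n : ℕ in atTop, 10 ^ 7 * (Real.log n + 1) ≤ (n / 2 : ℕ) * (p n : ℝ) := by
  have h1 := hp.bound (c := 1) one_pos
  have h2 : (fun x : ℝ => Real.log x) =o[atTop] fun x : ℝ => x ^ (1 - ε) :=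
    isLittleO_log_rpow_atTop (by linarith)
  have h3 : (fun _ : ℝ => (1 : ℝ)) =o[atTop] fun x : ℝ => x ^ (1 - ε) :=
    (Asymptotics.isLittleO_const_left.2 (Or.inr
      (tendsto_norm_atTop_atTop.comp (tendsto_rpow_atTop (by linarith)))))
  have h4 := ((h2.add h3).comp_tendsto tendsto_natCast_atTop_atTop).bound
    (c := 1 / (3 * 10 ^ 7)) (by norm_num)
  filter_upwards [h1, h4, eventually_ge_atTop 1000] with n hn1 hn2 hn
  have hn0 : (0 : ℝ) < n := by exact_mod_cast (by omega : 0 < n)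
  have hp0 : (0 : ℝ) ≤ p n := (p n).2.1
  rw [Real.norm_of_nonneg (by positivity), Real.norm_of_nonneg hp0, one_mul] at hn1
  simp only [Function.comp] at hn2
  rw [Real.norm_of_nonneg (by positivity : (0 : ℝ) ≤ (n : ℝ) ^ (1 - ε))] at hn2
  have h5 := (le_abs_self _).trans hn2
  have h6 : (n : ℝ) ^ (1 - ε) = n * (n : ℝ) ^ (-ε) := by
    rw [sub_eq_add_neg, Real.rpow_add hn0, Real.rpow_one]
  have h7 := (half_bounds hp0 hn).1
  have h8 : (n : ℝ) * (n : ℝ) ^ (-ε) ≤ 3 * (n / 2 : ℕ) * p n := by gcongr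
  rw [h6] at h5
  linarith

theorem abs_logb_logb_div_le {x y : ℝ} (hx : 2 ≤ x) (hxy : x ≤ y) :
    |Real.logb 2 (Real.logb 2 y) / Real.logb 2 y| ≤ 3 / √(Real.logb 2 x) := by
  have hx1 : 1 ≤ Real.logb 2 x := by
    rw [Real.le_logb_iff_rpow_le (by norm_num) (by linarith)]
    simpa using hx
  have hxy' : Real.logb 2 x ≤ Real.logb 2 y :=
    Real.logb_le_logb_of_le (by norm_num) (by linarith) hxy
  have hy1 := hx1.trans hxy'
  rw [abs_of_nonneg (div_nonneg (Real.logb_nonneg (by norm_num) hy1) (by linarith))]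
  calc Real.logb 2 (Real.logb 2 y) / Real.logb 2 y
      ≤ 3 * √(Real.logb 2 y) / Real.logb 2 y := by
        gcongr
        exact logb_two_le_three_mul_sqrt (by linarith)
    _ = 3 / √(Real.logb 2 y) := by
        rw [mul_div_assoc, Real.sqrt_div_self', mul_one_div]
    _ ≤ 3 / √(Real.logb 2 x) := by gcongr

end SimpleGraph

theorem corollary2 :
    ∃ C : ℝ, 0 < C ∧
      ∀ (ε : ℝ), 0 < ε → ε < 1 →
      ∀ (p : ℕ → unitInterval),
        Asymptotics.IsLittleO Filter.atTop
          (fun n : ℕ => (n : ℝ) ^ (-ε)) (fun n : ℕ => (p n : ℝ)) →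
        ∃ η : ℕ → ℝ, Filter.Tendsto η Filter.atTop (nhds 0) ∧
          Filter.Tendsto
            (fun n : ℕ => SimpleGraph.binomialRandom (Fin n) (p n)
              {G : SimpleGraph (Fin n) |
                (G.cfChromaticIndex : ℝ) ≤
                    Real.logb 2 G.maxDeg + C * Real.logb 2 (Real.logb 2 G.maxDeg) ∧
                ∃ h : ℝ, |h| ≤ η n ∧
                  Real.logb 2 G.maxDeg + C * Real.logb 2 (Real.logb 2 G.maxDeg) =
                    (1 + h) * Real.logb 2 G.maxDeg})
            Filter.atTop (nhds 1) := by
  -- `C = 1` works because the bound `log₂ Δ + 7` has only a constant excess.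
  refine ⟨1, one_pos, fun ε _ hε p hp => ?_⟩
  have hL := SimpleGraph.eventually_mul_log_add_one_le hε hp
  have hLtop : Tendsto (fun n : ℕ => (n / 2 : ℕ) * (p n : ℝ) / 2) atTop atTop := by
    refine Tendsto.atTop_div_const two_pos (tendsto_atTop_mono' _ ?_
      (Real.tendsto_log_atTop.comp tendsto_natCast_atTop_atTop))
    filter_upwards [hL, eventually_ge_atTop 1] with n hn hn1
    have : 0 ≤ Real.log n := Real.log_nonneg (by exact_mod_cast hn1)
    simp only [Function.comp]
    linarith
  -- This is the bound of `abs_logb_logb_div_le` at the lower bound `m * p / 2` for `Δ`, with `m = n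
  -- / 2`.
  refine ⟨fun n => 3 / √(Real.logb 2 ((n / 2 : ℕ) * (p n : ℝ) / 2)), ?_, ?_⟩
  · exact tendsto_const_nhds.div_atTop (Real.tendsto_sqrt_atTop.comp
      ((Real.tendsto_logb_atTop (by norm_num)).comp hLtop))
  rw [← ENNReal.tendsto_toReal_iff (fun n => measure_ne_top _ _) ENNReal.one_ne_top,
    ENNReal.toReal_one]
  refine tendsto_of_tendsto_of_tendsto_of_le_of_le' (g := fun n : ℕ => 1 - 3 / (n : ℝ)) ?_
    tendsto_const_nhds ?_ (.of_forall fun n => measureReal_le_one)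
  · simpa using (tendsto_const_div_atTop_nhds_zero_nat (3 : ℝ)).const_sub 1
  -- `2 ^ 128` makes `log₂ Δ ≥ 128 = 2 ^ 7`, hence `log₂ log₂ Δ ≥ 7`.
  filter_upwards [hL, eventually_ge_atTop 1000, hLtop.eventually_ge_atTop (2 ^ 128)] with
    n hn hn1 hn2
  have hprob := SimpleGraph.binomialRandom_not_isCrossPseudorandom_le_three_div (p n) hn1 hn
  have hcompl := probReal_compl_eq_one_sub (μ := SimpleGraph.binomialRandom (Fin n) (p n))
    (s := {G | ¬ G.IsCrossPseudorandom (finLowerHalf n) (finUpperHalf n) (p n) (n / 2 / 200)})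
    (MeasurableSet.of_discrete)
  refine le_trans (by rw [hcompl]; linarith) (measureReal_mono (μ :=
    SimpleGraph.binomialRandom (Fin n) (p n)) (s₁ := {G | ¬ G.IsCrossPseudorandom
      (finLowerHalf n) (finUpperHalf n) (p n) (n / 2 / 200)}ᶜ) ?_)
  intro G hG
  replace hG := not_not.1 hG
  have hne : Nonempty (Fin (n / 2)) := ⟨⟨0, by omega⟩⟩
  have hΔ := hG.lt_maxDeg (injective_sumElim_finHalves n)
  rw [Fintype.card_fin] at hΔ
  have hlog : 128 ≤ Real.logb 2 G.maxDeg := by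
    rw [Real.le_logb_iff_rpow_le (by norm_num) (by linarith)]
    refine le_trans ?_ (hn2.trans hΔ.le)
    norm_num
  have hloglog : 7 ≤ Real.logb 2 (Real.logb 2 G.maxDeg) := by
    rw [Real.le_logb_iff_rpow_le (by norm_num) (by linarith)]
    refine le_trans ?_ hlog
    norm_num
  refine ⟨?_, Real.logb 2 (Real.logb 2 G.maxDeg) / Real.logb 2 G.maxDeg,
    SimpleGraph.abs_logb_logb_div_le (by linarith) hΔ.le, ?_⟩
  · have := hG.cfChromaticIndex_le_logb (p n).2.1 hn1 hn
    linarith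
  · field_simp
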